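/- For integers $k\ge 0$ let $\binom{x}{k}=\frac{x(x-1)\cdots(x-k+1)}{k!}$, a polynomial in $x$. For integers $n\ge 0$ define $$d_n(x)=\sum_{k=0}^n\binom nk\binom xk 2^k,\qquad s_n(x)=\sum_{k=0}^n\binom nk\binom xk\binom{x+k}k .$$ A polynomial $P(x)$ with real coefficients is called integer-valued if $P(x)\in\mathbb Z$ for all $x\in\mathbb Z$. Theorem. Let $m$ and $n$ be positive integers. Then all of the following six polynomials in $x$ are integer-valued: $$\frac{x(x+1)}{2n^2}\sum_{k=0}^{n-1}(2k+1)d_k(x)^2,\qquad \frac1n\sum_{k=0}^{n-1}(2k+1)d_k(x)^{2m},\qquad \frac1n\sum_{k=0}^{n-1}(-1)^k(2k+1)d_k(x)^{2m},$$ $$\frac1{n^2}\sum_{k=0}^{n-1}(2k+1)s_k(x)^2,\qquad \frac1n\sum_{k=0}^{n-1}(2k+1)s_k(x)^{2m},\qquad \frac1n\sum_{k=0}^{n-1}(-1)^k(2k+1)s_k(x)^{2m}.$$ -/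

import Mathlib

open Polynomial

noncomputable section

/-- The binomial coefficient `binom(x, k) = x (x - 1) ⋯ (x - k + 1) / k!` as a real polynomial
in the indeterminate `x`. -/
def binomPoly (k : ℕ) : ℝ[X] :=
  C ((k.factorial : ℝ)⁻¹) * ∏ i ∈ Finset.range k, (X - C (i : ℝ))

/-- The polynomial `d_n(x) = ∑_{k=0}^n binom(n, k) binom(x, k) 2^k`. -/
def sunD (n : ℕ) : ℝ[X] :=
  ∑ k ∈ Finset.range (n + 1), C ((n.choose k : ℝ)) * binomPoly k * C ((2 : ℝ) ^ k)

/-- The polynomial `s_n(x) = ∑_{k=0}^n binom(n, k) binom(x, k) binom(x + k, k)`. -/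
def sunS (n : ℕ) : ℝ[X] :=
  ∑ k ∈ Finset.range (n + 1),
    C ((n.choose k : ℝ)) * binomPoly k * (binomPoly k).comp (X + C (k : ℝ))

/-- A real polynomial is integer-valued if it takes integer values at all integers. -/
def IsIntegerValued (P : ℝ[X]) : Prop :=
  ∀ x : ℤ, ∃ z : ℤ, P.eval (x : ℝ) = (z : ℝ)

end

/-! Write b_j(k) = binom(k, j) binom(k + j, j), which is `pairBinom` at k (k + 1). The sums of (2k +
1) b_j(k) and (-1)^k (2k + 1) b_j(k) over k < n telescope by `pairBinom_shift` and are integer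
multiples of n. The integer span of the b_j is closed under products (`pairBinom_mul`), so for the
divisions by n it suffices that d_k(x)^2 and s_k(x)^2, as functions of k, lie in it. Both depend on
x only through x (x + 1), so x may be taken in ℕ. Then d_k(x)^2 = ∑_j 4^j binom(x + j, 2j) b_j(k),
while b_j(k) has coefficient ∑_l binom(l, j) binom(2j, l) b_l(x) in s_k(x)^2.

Division by n^2 leaves a denominator j + 1 in the j-th term. For s it divides the factor binom(2j,
j) of the coefficient (Catalan numbers); for d it divides x (x + 1) / 2 * 4^j binom(x + j, 2j). -/

open Polynomial

/-! ### The products b_j and their weighted sums -/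

/-- The product of `(y - i (i + 1)) / (i + 1) ^ 2` over `i < j`; at `y = x (x + 1)` it equals
`binom(x, j) binom(x + j, j)`. -/
noncomputable def pairBinom (y : ℝ) (j : ℕ) : ℝ :=
  ∏ i ∈ Finset.range j, (y - i * (i + 1)) / ((i : ℝ) + 1) ^ 2

@[simp] lemma pairBinom_zero (y : ℝ) : pairBinom y 0 = 1 := by simp [pairBinom]

lemma sq_mul_pairBinom_succ (y : ℝ) (j : ℕ) :
    ((j : ℝ) + 1) ^ 2 * pairBinom y (j + 1) = (y - j * (j + 1)) * pairBinom y j := by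
  have : ((j : ℝ) + 1) ≠ 0 := by positivity
  rw [pairBinom, pairBinom, Finset.prod_range_succ]
  field_simp

/-- The defining ratio of consecutive binomial coefficients, without subtraction in `ℕ`. -/
lemma cast_choose_succ_mul (n k : ℕ) :
    ((n.choose (k + 1) : ℕ) : ℝ) * ((k : ℝ) + 1) = n.choose k * ((n : ℝ) - k) := by
  rcases le_or_gt k n with h | h
  · have := Nat.choose_succ_right_eq n k
    rw [← Nat.cast_sub h]
    exact_mod_cast this
  · simp [Nat.choose_eq_zero_of_lt h, Nat.choose_eq_zero_of_lt (Nat.lt_succ_of_lt h)]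

lemma cast_succ_choose_mul (n k : ℕ) :
    (((n + 1).choose k : ℕ) : ℝ) * ((n : ℝ) + 1 - k) = n.choose k * ((n : ℝ) + 1) := by
  rcases le_or_gt k (n + 1) with h | h
  · have := Nat.choose_mul_succ_eq n k
    have e : (n : ℝ) + 1 - k = ((n + 1 - k : ℕ) : ℝ) := by push_cast [Nat.cast_sub h]; ring
    rw [e]
    exact_mod_cast this.symm
  · simp [Nat.choose_eq_zero_of_lt h, Nat.choose_eq_zero_of_lt (Nat.lt_of_succ_lt h)]

lemma cast_add_succ_choose_succ (n j : ℕ) :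
    (((n + (j + 1)).choose (j + 1) : ℕ) : ℝ) * ((j : ℝ) + 1) =
      (n + j).choose j * ((n : ℝ) + j + 1) := by
  have := Nat.add_one_mul_choose_eq (n + j) j
  rw [← add_assoc]
  have h : (((n + j + 1 : ℕ) : ℝ)) * (n + j).choose j = (n + j + 1).choose (j + 1) * ((j + 1 : ℕ) : ℝ) := by
    exact_mod_cast this
  push_cast at h
  linarith

lemma pairBinom_nat (n j : ℕ) :
    pairBinom ((n : ℝ) * (n + 1)) j = n.choose j * (n + j).choose j := by
  induction j with
  | zero => simp
  | succ j ih =>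
    have h1 := sq_mul_pairBinom_succ ((n : ℝ) * (n + 1)) j
    have h2 := cast_choose_succ_mul n j
    have h3 := cast_add_succ_choose_succ n j
    have h0 : ((j : ℝ) + 1) ^ 2 ≠ 0 := by positivity
    apply mul_left_cancel₀ h0
    rw [h1, ih]
    linear_combination (-((n + (j + 1)).choose (j + 1) : ℝ) * (j + 1)) * h2 -
      (n.choose j * ((n : ℝ) - j)) * h3

lemma pairBinom_nat_eq_centralBinom_mul (n j : ℕ) :
    pairBinom ((n : ℝ) * (n + 1)) j = (j.centralBinom : ℝ) * (n + j).choose (2 * j) := by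
  rw [pairBinom_nat]
  rcases le_or_gt j n with h | h
  · have := Nat.choose_mul (n := n + j) (k := 2 * j) (s := j) (by omega)
    rw [Nat.add_sub_cancel, show 2 * j - j = j by omega] at this
    rw [Nat.centralBinom]
    exact_mod_cast (by linarith : n.choose j * (n + j).choose j = _)
  · simp [Nat.choose_eq_zero_of_lt h, Nat.choose_eq_zero_of_lt (by omega : n + j < 2 * j)]

/-- The ratio of consecutive values, cleared of denominators because n + 1 - j may vanish. It drives
both telescoping sums below. -/
lemma pairBinom_shift (n : ℝ) (j : ℕ) :
    (n + 1 - j) * pairBinom ((n + 1) * (n + 1 + 1)) j = (n + 1 + j) * pairBinom (n * (n + 1)) j := by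
  induction j with
  | zero => simp
  | succ j ih =>
    have h1 := sq_mul_pairBinom_succ (n * (n + 1)) j
    have h2 := sq_mul_pairBinom_succ ((n + 1) * (n + 1 + 1)) j
    have h0 : ((j : ℝ) + 1) ^ 2 ≠ 0 := by positivity
    apply mul_left_cancel₀ h0
    push_cast
    linear_combination (n - j) * h2 - (n + 2 + j) * h1 + (n - j) * (n + 2 + j) * ih

lemma sum_odd_mul_pairBinom (n j : ℕ) :
    ∑ k ∈ Finset.range n, (2 * (k : ℝ) + 1) * pairBinom ((k : ℝ) * (k + 1)) j =
      n * (n - j) * pairBinom ((n : ℝ) * (n + 1)) j / (j + 1) := by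
  have h0 : ((j : ℝ) + 1) ≠ 0 := by positivity
  induction n with
  | zero => simp
  | succ n ih =>
    have h := pairBinom_shift n j
    rw [Finset.sum_range_succ, ih]
    push_cast
    field_simp
    linear_combination (-(n + 1) : ℝ) * h

lemma sum_alternating_odd_mul_pairBinom (n j : ℕ) :
    ∑ k ∈ Finset.range n, (-1) ^ k * (2 * (k : ℝ) + 1) * pairBinom ((k : ℝ) * (k + 1)) j =
      -((-1) ^ n * ((n - j) * pairBinom ((n : ℝ) * (n + 1)) j)) := by
  induction n with
  | zero => rcases j with _ | j <;> simp [pairBinom, Finset.prod_range_succ']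
  | succ n ih =>
    have h := pairBinom_shift n j
    rw [Finset.sum_range_succ, ih]
    push_cast
    rw [pow_succ]
    linear_combination (-(-1) ^ n : ℝ) * h

/-! ### Linearization of products -/

/-- The coefficients of the linearization formula. -/
def linCoeff (i j l : ℕ) : ℕ := l.choose i * l.choose j * (i + j).choose l

lemma linCoeff_rec_zero (i j : ℕ) : ((i : ℝ) + 1) ^ 2 * linCoeff (i + 1) j 0 =
    (0 - (i : ℝ) * (i + 1)) * linCoeff i j 0 := by
  rcases i with _ | i <;> simp [linCoeff]

/-- Coefficient comparison after multiplying by y - i (i + 1), split as (y - l (l + 1)) + (l (l + 1)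
- i (i + 1)): the first part raises the index l, the second keeps it. -/
lemma linCoeff_rec (i j l : ℕ) : ((i : ℝ) + 1) ^ 2 * linCoeff (i + 1) j (l + 1) =
    ((l : ℝ) + 1) ^ 2 * linCoeff i j l +
      (((l : ℝ) + 1) * (l + 2) - i * (i + 1)) * linCoeff i j (l + 1) := by
  have a1 := cast_choose_succ_mul (l + 1) i
  have a2 := cast_succ_choose_mul l i
  have a3 := cast_succ_choose_mul l j
  have a4 := cast_choose_succ_mul (i + j) l
  have a5 : (((i + 1 + j).choose (l + 1) : ℕ) : ℝ) = (i + j).choose l + (i + j).choose (l + 1) := by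
    rw [show i + 1 + j = (i + j) + 1 by ring, Nat.choose_succ_succ]; push_cast; ring
  simp only [linCoeff]
  push_cast at *
  rw [a5]
  generalize ((l + 1).choose (i + 1) : ℝ) = p1 at *
  generalize ((l + 1).choose i : ℝ) = p at *
  generalize ((l + 1).choose j : ℝ) = q at *
  generalize (l.choose i : ℝ) = p0 at *
  generalize (l.choose j : ℝ) = q0 at *
  generalize ((i + j).choose l : ℝ) = r at *
  generalize ((i + j).choose (l + 1) : ℝ) = r1 at *
  have b : ((l : ℝ) + 1) ^ 2 * (p0 * q0 * r) = p * (l + 1 - i) * (q * (l + 1 - j)) * r := by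
    rw [a2, a3]; ring
  rw [b]
  linear_combination (q * (r + r1) * (i + 1)) * a1 - p * q * (l + 1 - i) * a4

lemma pairBinom_mul (y : ℝ) (i j : ℕ) {N : ℕ} (hN : i + j < N) :
    pairBinom y i * pairBinom y j =
      ∑ l ∈ Finset.range N, (linCoeff i j l : ℝ) * pairBinom y l := by
  induction i generalizing N with
  | zero =>
    rw [Finset.sum_eq_single j]
    · simp [linCoeff]
    · intro l _ hl
      rcases lt_or_gt_of_ne hl with h | h
      · simp [linCoeff, Nat.choose_eq_zero_of_lt h]
      · simp [linCoeff, Nat.choose_eq_zero_of_lt h]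
    · intro h; simp at h; omega
  | succ i ih =>
    obtain ⟨N, rfl⟩ : ∃ M, N = M + 1 := ⟨N - 1, by omega⟩
    have h0 : ((i : ℝ) + 1) ^ 2 ≠ 0 := by positivity
    apply mul_left_cancel₀ h0
    rw [← mul_assoc, sq_mul_pairBinom_succ, mul_assoc, ih (N := N) (by omega), Finset.mul_sum,
      Finset.mul_sum]
    have hz : (linCoeff i j N : ℝ) = 0 := by
      simp [linCoeff, Nat.choose_eq_zero_of_lt (by omega : i + j < N)]
    -- Truncated sums differ only by a boundary term at M, which vanishes at M = N by `hz`.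
    have key : ∀ M, ∑ l ∈ Finset.range (M + 1),
          ((i : ℝ) + 1) ^ 2 * ((linCoeff (i + 1) j l : ℝ) * pairBinom y l) =
        ∑ l ∈ Finset.range M, (y - i * (i + 1)) * ((linCoeff i j l : ℝ) * pairBinom y l) +
          (M * (M + 1) - i * (i + 1)) * linCoeff i j M * pairBinom y M := by
      intro M
      induction M with
      | zero =>
        have := linCoeff_rec_zero i j
        simp only [zero_add, Finset.range_one, Finset.sum_singleton, pairBinom_zero, mul_one,
          Finset.range_zero, Finset.sum_empty, this]
        push_cast; ring
      | succ M ihM =>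
        rw [Finset.sum_range_succ, ihM, Finset.sum_range_succ _ M]
        have h1 := linCoeff_rec i j M
        have h2 := sq_mul_pairBinom_succ y M
        push_cast
        linear_combination pairBinom y (M + 1) * h1 + linCoeff i j M * h2
    rw [key, hz]
    ring

/-! ### Evaluation of d_n and s_n -/

lemma eval_binomPoly_zero (x : ℝ) : (binomPoly 0).eval x = 1 := by simp [binomPoly]

lemma eval_binomPoly_succ_mul (x : ℝ) (k : ℕ) :
    (binomPoly (k + 1)).eval x * ((k : ℝ) + 1) = (binomPoly k).eval x * (x - k) := by
  have h1 : ((k : ℝ) + 1) ≠ 0 := by positivity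
  have h2 : (k.factorial : ℝ) ≠ 0 := by positivity
  simp only [binomPoly, Finset.prod_range_succ, Nat.factorial_succ, eval_mul, eval_C, eval_sub,
    eval_X]
  push_cast
  field_simp

lemma eval_binomPoly_shift_mul (x : ℝ) (k : ℕ) :
    (binomPoly (k + 1)).eval (x + ((k : ℝ) + 1)) * ((k : ℝ) + 1) =
      (binomPoly k).eval (x + k) * (x + k + 1) := by
  have h1 : ((k : ℝ) + 1) ≠ 0 := by positivity
  have h2 : (k.factorial : ℝ) ≠ 0 := by positivity
  simp only [binomPoly, Finset.prod_range_succ', Nat.factorial_succ, eval_mul, eval_C, eval_sub,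
    eval_X, eval_prod]
  push_cast
  have : ∀ i : ℕ, x + ((k : ℝ) + 1) - (i + 1) = x + k - i := fun i => by ring
  simp only [this]
  field_simp
  ring

/-- The factors pair up as (x - i) (x + i + 1) = x (x + 1) - i (i + 1). -/
lemma eval_binomPoly_mul_shift (x : ℝ) (k : ℕ) :
    (binomPoly k).eval x * (binomPoly k).eval (x + k) = pairBinom (x * (x + 1)) k := by
  induction k with
  | zero => simp [eval_binomPoly_zero]
  | succ k ih =>
    have h1 := eval_binomPoly_succ_mul x k
    have h2 := eval_binomPoly_shift_mul x k
    have h3 := sq_mul_pairBinom_succ (x * (x + 1)) k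
    have h0 : ((k : ℝ) + 1) ^ 2 ≠ 0 := by positivity
    apply mul_left_cancel₀ h0
    rw [h3, ← ih]
    push_cast
    linear_combination ((binomPoly (k + 1)).eval (x + ((k : ℝ) + 1)) * (k + 1)) * h1 +
      ((binomPoly k).eval x * (x - k)) * h2

/-- The free bound N lets sums for different n share one range. -/
lemma eval_sunS (x : ℝ) {n N : ℕ} (h : n < N) :
    (sunS n).eval x = ∑ k ∈ Finset.range N, (n.choose k : ℝ) * pairBinom (x * (x + 1)) k := by
  rw [← Finset.sum_subset (Finset.range_mono h)]
  · simp only [sunS, eval_finsetSum, eval_mul, eval_C, eval_comp, eval_add, eval_X, mul_assoc,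
      eval_binomPoly_mul_shift]
  · intro k _ hk
    simp only [Finset.mem_range, not_lt] at hk
    simp [Nat.choose_eq_zero_of_lt (by omega : n < k)]

lemma eval_sunD (x : ℝ) {n N : ℕ} (h : n < N) :
    (sunD n).eval x =
      ∑ k ∈ Finset.range N, (n.choose k : ℝ) * ((binomPoly k).eval x * 2 ^ k) := by
  rw [← Finset.sum_subset (Finset.range_mono h)]
  · simp only [sunD, eval_finsetSum, eval_mul, eval_C, mul_assoc]
  · intro k _ hk
    simp only [Finset.mem_range, not_lt] at hk
    simp [Nat.choose_eq_zero_of_lt (by omega : n < k)]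

/-! ### The squares of d_n -/

lemma sunD_recurrence (x : ℝ) (n : ℕ) :
    ((n : ℝ) + 2) * (sunD (n + 2)).eval x =
      (2 * x + 1) * (sunD (n + 1)).eval x + (n + 1) * (sunD n).eval x := by
  rw [eval_sunD x (by omega : n < n + 3), eval_sunD x (by omega : n + 1 < n + 3),
    eval_sunD x (by omega : n + 2 < n + 3)]
  -- Creative telescoping: the right side is the certificate, zero at M = n + 3. Its factor M makes
  -- the truncated `M - 1` harmless at M = 0.
  have key : ∀ M : ℕ, ∑ k ∈ Finset.range M, ((binomPoly k).eval x * 2 ^ k) *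
      (((n : ℝ) + 2) * (n + 2).choose k - (2 * x + 1) * (n + 1).choose k - (n + 1) * n.choose k) =
      - (M * (n + 1).choose (M - 1) * ((binomPoly M).eval x * 2 ^ M)) := by
    intro M
    induction M with
    | zero => simp
    | succ M ih =>
      rw [Finset.sum_range_succ, ih]
      have h1 := eval_binomPoly_succ_mul x M
      have h2 := cast_succ_choose_mul n M
      have h3 := cast_succ_choose_mul (n + 1) M
      rcases M with _ | M
      · simp only [zero_add, pow_one, Nat.choose_zero_right, pow_zero] at *
        push_cast at *
        rw [Nat.choose_zero_right]
        push_cast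
        linear_combination 2 * h1
      · have h4 : (((n + 2).choose (M + 1) : ℕ) : ℝ) =
            (n + 1).choose M + (n + 1).choose (M + 1) := by
          rw [Nat.choose_succ_succ]; push_cast; ring
        have h5 := cast_choose_succ_mul (n + 1) M
        simp only [Nat.add_sub_cancel]
        push_cast at *
        rw [h4] at h3 ⊢
        generalize ((n + 1).choose (M + 1) : ℝ) = p at *
        generalize ((n + 1).choose M : ℝ) = q at *
        generalize (n.choose (M + 1) : ℝ) = r at *
        generalize eval x (binomPoly (M + 1)) = u at *
        generalize eval x (binomPoly (M + 1 + 1)) = v at *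
        rw [pow_succ 2 (M + 1)]
        generalize (2 : ℝ) ^ (M + 1) = w at *
        linear_combination (2 * p * w) * h1 + (w * u) * (h2 - h5)
  have := key (n + 3)
  simp only [Nat.choose_eq_zero_of_lt (by omega : n + 1 < n + 3 - 1), Nat.cast_zero, mul_zero,
    zero_mul, neg_zero] at this
  rw [← sub_eq_zero, ← this, Finset.mul_sum, Finset.mul_sum, Finset.mul_sum,
    ← Finset.sum_add_distrib, ← Finset.sum_sub_distrib]
  exact Finset.sum_congr rfl fun k _ => by ring

lemma choose_even_recurrence (m j : ℕ) :
    ((m : ℝ) + 2) ^ 2 * (m + 3 + j).choose (2 * j + 2) -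
        (m + 1) ^ 2 * (m + 1 + j).choose (2 * j + 2) =
      (4 * ((j : ℝ) + 1) * (j + 2) + 1) *
          ((m + 3 + j).choose (2 * j + 3) + (m + 2 + j).choose (2 * j + 3)) +
        (j + 1) ^ 2 * ((m + 2 + j).choose (2 * j + 1) + (m + 1 + j).choose (2 * j + 1)) := by
  have h1 := cast_choose_succ_mul (m + 1 + j) (2 * j)
  have h2 := cast_choose_succ_mul (m + 1 + j) (2 * j + 1)
  have h3 := cast_choose_succ_mul (m + 1 + j) (2 * j + 2)
  rw [show m + 3 + j = m + 1 + j + 1 + 1 by ring, show m + 2 + j = m + 1 + j + 1 by ring]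
  simp only [Nat.choose_succ_succ]
  simp only [Nat.succ_eq_add_one, add_assoc, Nat.reduceAdd] at *
  push_cast at *
  generalize ((m + (1 + j)).choose (2 * j) : ℝ) = c0 at *
  generalize ((m + (1 + j)).choose (2 * j + 1) : ℝ) = c1 at *
  generalize ((m + (1 + j)).choose (2 * j + 2) : ℝ) = c2 at *
  generalize ((m + (1 + j)).choose (2 * j + 3) : ℝ) = c3 at *
  have e1 : c1 = c0 * (m + 1 - j) / (2 * j + 1) := by
    rw [eq_div_iff (by positivity)]; linear_combination h1
  have e2 : c2 = c1 * (m - j) / (2 * j + 2) := by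
    rw [eq_div_iff (by positivity)]; linear_combination h2
  have e3 : c3 = c2 * (m - 1 - j) / (2 * j + 3) := by
    rw [eq_div_iff (by positivity)]; linear_combination h3
  rw [e3, e2, e1]
  field_simp
  ring

/-- The sum `∑_j binom(n + j, 2 j) binom(x, j) binom(x + j, j) 4 ^ j` in terms of
`y = x (x + 1)`. -/
noncomputable def squareSum (y : ℝ) (N n : ℕ) : ℝ :=
  ∑ j ∈ Finset.range N, ((n + j).choose (2 * j) : ℝ) * (4 ^ j * pairBinom y j)

/-- The partial sums of `squareSum` over `n`. -/
noncomputable def squareSumPrimitive (y : ℝ) (N n : ℕ) : ℝ :=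
  ∑ j ∈ Finset.range N, ((n + 1 + j).choose (2 * j + 1) : ℝ) * (4 ^ j * pairBinom y j)

lemma squareSumPrimitive_succ (y : ℝ) (N n : ℕ) :
    squareSumPrimitive y N (n + 1) = squareSumPrimitive y N n + squareSum y N (n + 1) := by
  simp only [squareSumPrimitive, squareSum, ← Finset.sum_add_distrib]
  refine Finset.sum_congr rfl fun j _ => ?_
  rw [show n + 1 + 1 + j = n + 1 + j + 1 by ring, Nat.choose_succ_succ]
  push_cast
  ring

lemma squareSum_recurrence (y : ℝ) {N n : ℕ} (h : n + 2 < N) :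
    ((n : ℝ) + 2) ^ 2 * squareSum y N (n + 2) - (n + 1) ^ 2 * squareSum y N n =
      (4 * y + 1) * (squareSumPrimitive y N (n + 1) + squareSumPrimitive y N n) := by
  -- Again a telescoping certificate; its binomials vanish once M ≥ n + 2.
  have key : ∀ M : ℕ, ∑ j ∈ Finset.range (M + 1), (4 ^ j * pairBinom y j) *
      (((n : ℝ) + 2) ^ 2 * (n + 2 + j).choose (2 * j) - (n + 1) ^ 2 * (n + j).choose (2 * j) -
        (4 * y + 1) * ((n + 2 + j).choose (2 * j + 1) + (n + 1 + j).choose (2 * j + 1))) =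
      - (4 * (y - M * (M + 1)) * (4 ^ M * pairBinom y M) *
        ((n + 2 + M).choose (2 * M + 1) + (n + 1 + M).choose (2 * M + 1))) := by
    intro M
    induction M with
    | zero =>
      simp
      ring
    | succ M ih =>
      rw [Finset.sum_range_succ, ih]
      have h1 := sq_mul_pairBinom_succ y M
      have h2 := choose_even_recurrence n M
      rw [show n + 2 + (M + 1) = n + 3 + M by ring, show n + (M + 1) = n + 1 + M by ring,
        show n + 1 + (M + 1) = n + 2 + M by ring, show 2 * (M + 1) = 2 * M + 2 by ring,
        show 2 * M + 2 + 1 = 2 * M + 3 by ring, pow_succ]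
      push_cast
      linear_combination (4 * 4 ^ M * ((n + 2 + M).choose (2 * M + 1) +
        (n + 1 + M).choose (2 * M + 1) : ℝ)) * h1 + 4 * 4 ^ M * pairBinom y (M + 1) * h2
  obtain ⟨N, rfl⟩ : ∃ M, N = M + 1 := ⟨N - 1, by omega⟩
  have := key N
  rw [Nat.choose_eq_zero_of_lt (by omega : n + 2 + N < 2 * N + 1),
    Nat.choose_eq_zero_of_lt (by omega : n + 1 + N < 2 * N + 1)] at this
  simp only [Nat.cast_zero, add_zero, mul_zero, neg_zero] at this
  rw [← sub_eq_zero, ← this]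
  simp only [squareSum, squareSumPrimitive]
  rw [Finset.mul_sum, Finset.mul_sum, ← Finset.sum_add_distrib, Finset.mul_sum,
    ← Finset.sum_sub_distrib, ← Finset.sum_sub_distrib]
  exact Finset.sum_congr rfl fun k _ => by
    rw [show n + 1 + 1 + k = n + 2 + k by ring]; ring

lemma squareSum_zero (y : ℝ) {N : ℕ} (h : 0 < N) : squareSum y N 0 = 1 := by
  rw [squareSum, Finset.sum_eq_single 0]
  · simp
  · intro j _ hj
    rw [Nat.choose_eq_zero_of_lt (by omega : 0 + j < 2 * j), Nat.cast_zero, zero_mul]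
  · intro h; simp at h; omega

lemma squareSum_one (y : ℝ) {N : ℕ} (h : 1 < N) : squareSum y N 1 = 4 * y + 1 := by
  rw [squareSum, ← Finset.sum_subset (Finset.range_mono h)]
  · simp [Finset.sum_range_succ, pairBinom]; ring
  · intro j _ hj
    simp only [Finset.mem_range, not_lt] at hj
    simp [Nat.choose_eq_zero_of_lt (by omega : 1 + j < 2 * j)]

lemma squareSumPrimitive_zero (y : ℝ) {N : ℕ} (h : 0 < N) : squareSumPrimitive y N 0 = 1 := by
  rw [squareSumPrimitive, Finset.sum_eq_single 0]
  · simp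
  · intro j _ hj
    simp [Nat.choose_eq_zero_of_lt (by omega : 0 + 1 + j < 2 * j + 1)]
  · intro h; simp at h; omega

lemma eval_sunD_zero (x : ℝ) : (sunD 0).eval x = 1 := by simp [sunD, binomPoly]

lemma eval_sunD_one (x : ℝ) : (sunD 1).eval x = 2 * x + 1 := by
  simp [sunD, binomPoly, Finset.sum_range_succ]; ring

/-- The squares alone do not close the induction, so d_n d_{n+1} is carried along. Multiplying the
three-term recurrence by (n + 2) d_{n+2} + (n + 1) d_n turns it into the recurrence of `squareSum`,
since (2x + 1)^2 = 4 x (x + 1) + 1. -/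
lemma eval_sunD_sq_aux (x : ℝ) (N n : ℕ) (h : n + 1 < N) :
    (sunD n).eval x ^ 2 = squareSum (x * (x + 1)) N n ∧
    (sunD (n + 1)).eval x ^ 2 = squareSum (x * (x + 1)) N (n + 1) ∧
    ((n : ℝ) + 1) * ((sunD n).eval x * (sunD (n + 1)).eval x) =
      (2 * x + 1) * squareSumPrimitive (x * (x + 1)) N n := by
  induction n with
  | zero =>
    rw [squareSum_zero _ (by omega), zero_add, squareSum_one _ h,
      squareSumPrimitive_zero _ (by omega), eval_sunD_zero, eval_sunD_one]
    refine ⟨by ring, by ring, by push_cast; ring⟩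
  | succ n ih =>
    obtain ⟨h1, h2, h3⟩ := ih (by omega)
    have hrec := sunD_recurrence x n
    have hs := squareSum_recurrence (x * (x + 1)) (by omega : n + 2 < N)
    have hp := squareSumPrimitive_succ (x * (x + 1)) N n
    have h4 : ((n : ℝ) + 1 + 1) * ((sunD (n + 1)).eval x * (sunD (n + 2)).eval x) =
        (2 * x + 1) * squareSumPrimitive (x * (x + 1)) N (n + 1) := by
      rw [hp]
      linear_combination (sunD (n + 1)).eval x * hrec + h3 + (2 * x + 1) * h2
    refine ⟨h2, ?_, by push_cast; exact h4⟩
    have h0 : ((n : ℝ) + 2) ^ 2 ≠ 0 := by positivity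
    apply mul_left_cancel₀ h0
    rw [add_assoc n 1 1, one_add_one_eq_two]
    linear_combination (((n : ℝ) + 2) * (sunD (n + 2)).eval x + (n + 1) * (sunD n).eval x) * hrec +
      (2 * x + 1) * (h3 + h4) + (n + 1) ^ 2 * h1 - hs

lemma eval_sunD_sq (x : ℝ) {N n : ℕ} (h : n < N) :
    (sunD n).eval x ^ 2 = squareSum (x * (x + 1)) N n := by
  rw [(eval_sunD_sq_aux x (N + 1) n (by omega)).1, squareSum, Finset.sum_range_succ, squareSum,
    Nat.choose_eq_zero_of_lt (by omega : n + N < 2 * N)]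
  simp

/-- Both b_j(x) and b_j(n) contain binom(2j, j), so x and n can trade places. -/
lemma eval_sunD_sq_nat (x : ℕ) {N n : ℕ} (h : n < N) :
    (sunD n).eval (x : ℝ) ^ 2 = ∑ j ∈ Finset.range N,
      ((4 ^ j * (x + j).choose (2 * j) : ℤ) : ℝ) * pairBinom ((n : ℝ) * (n + 1)) j := by
  rw [eval_sunD_sq _ h, squareSum]
  refine Finset.sum_congr rfl fun j _ => ?_
  rw [pairBinom_nat_eq_centralBinom_mul, pairBinom_nat_eq_centralBinom_mul]
  push_cast
  ring

/-! ### The squares of `sunS` -/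

/-- Use binom(n, i) binom(i, r) = binom(n, r) binom(n - r, i - r), then Vandermonde. -/
lemma sum_choose_mul_choose_mul_choose (n r s : ℕ) {N : ℕ} (h : n < N) :
    ∑ i ∈ Finset.range N, n.choose i * (r + s).choose i * i.choose r =
      n.choose r * (n + s).choose s := by
  rcases lt_or_ge n r with hr | hr
  · rw [Nat.choose_eq_zero_of_lt hr, zero_mul]
    refine Finset.sum_eq_zero fun i _ => ?_
    rcases lt_or_ge n i with hi | hi
    · simp [Nat.choose_eq_zero_of_lt hi]
    · simp [Nat.choose_eq_zero_of_lt (by omega : i < r)]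
  obtain ⟨m, rfl⟩ := Nat.exists_eq_add_of_le hr
  have hv : (r + m + s).choose s = ∑ i ∈ Finset.range (s + 1), m.choose i * (r + s).choose (s - i) := by
    rw [show r + m + s = m + (r + s) by ring, Nat.add_choose_eq,
      Finset.Nat.sum_antidiagonal_eq_sum_range_succ_mk]
  have hv' : (r + m + s).choose s =
      ∑ i ∈ Finset.range (m + s + 1), m.choose i * (r + s).choose (r + i) := by
    rw [hv]
    have e : ∀ i ∈ Finset.range (s + 1), m.choose i * (r + s).choose (s - i) =
        m.choose i * (r + s).choose (r + i) := by
      intro i hi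
      rw [Finset.mem_range] at hi
      rw [← Nat.choose_symm_of_eq_add (by omega : r + s = (r + i) + (s - i))]
    rw [Finset.sum_congr rfl e]
    refine Finset.sum_subset (Finset.range_mono (by omega)) fun i _ hi => ?_
    rw [Finset.mem_range, not_lt] at hi
    rw [Nat.choose_eq_zero_of_lt (by omega : r + s < r + i), mul_zero]
  have hm : ∑ i ∈ Finset.range (m + s + 1), m.choose i * (r + s).choose (r + i) =
      ∑ i ∈ Finset.range (m + 1), m.choose i * (r + s).choose (r + i) := by
    symm
    refine Finset.sum_subset (Finset.range_mono (by omega)) fun i _ hi => ?_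
    rw [Finset.mem_range, not_lt] at hi
    rw [Nat.choose_eq_zero_of_lt (by omega : m < i), zero_mul]
  have hN : ∑ i ∈ Finset.range N, (r + m).choose i * (r + s).choose i * i.choose r =
      ∑ i ∈ Finset.range (r + (m + 1)), (r + m).choose i * (r + s).choose i * i.choose r := by
    symm
    refine Finset.sum_subset (Finset.range_mono (by omega)) fun i _ hi => ?_
    rw [Finset.mem_range, not_lt] at hi
    simp [Nat.choose_eq_zero_of_lt (by omega : r + m < i)]
  have h0 : ∑ i ∈ Finset.range r, (r + m).choose i * (r + s).choose i * i.choose r = 0 :=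
    Finset.sum_eq_zero fun i hi => by
      simp [Nat.choose_eq_zero_of_lt (Finset.mem_range.1 hi)]
  rw [hN, Finset.sum_range_add, h0, zero_add, hv', hm, Finset.mul_sum]
  refine Finset.sum_congr rfl fun i _ => ?_
  have := Nat.choose_mul (n := r + m) (k := r + i) (s := r) (by omega)
  rw [Nat.add_sub_cancel_left, Nat.add_sub_cancel_left] at this
  linear_combination (r + s).choose (r + i) * this

/-- Vandermonde splits binom(i + j, l) over p.1 + p.2 = l, after which the double sum factors. -/
lemma sum_choose_mul_linCoeff (n l : ℕ) {N : ℕ} (h : n < N) :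
    ∑ i ∈ Finset.range N, ∑ j ∈ Finset.range N, n.choose i * n.choose j * linCoeff i j l =
      ∑ p ∈ Finset.HasAntidiagonal.antidiagonal l, (n.choose p.1 * (n + p.1).choose p.1) *
        (n.choose p.2 * (n + p.2).choose p.2) := by
  have e : ∀ i j, n.choose i * n.choose j * linCoeff i j l =
      ∑ p ∈ Finset.HasAntidiagonal.antidiagonal l, (n.choose i * (p.1 + p.2).choose i * i.choose p.1) *
        (n.choose j * (p.2 + p.1).choose j * j.choose p.2) := by
    intro i j
    rw [linCoeff, Nat.add_choose_eq, Finset.mul_sum, Finset.mul_sum]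
    refine Finset.sum_congr rfl fun p hp => ?_
    rw [add_comm p.2, Finset.HasAntidiagonal.mem_antidiagonal.1 hp]
    ring
  simp only [e]
  rw [Finset.sum_congr rfl fun i _ => Finset.sum_comm, Finset.sum_comm]
  refine Finset.sum_congr rfl fun p _ => ?_
  rw [← Finset.sum_mul_sum, sum_choose_mul_choose_mul_choose n _ _ h,
    sum_choose_mul_choose_mul_choose n _ _ h]
  ring

lemma choose_mul_choose_eq_centralBinom {k l : ℕ} (h : k ≤ l) :
    (2 * k).choose l * l.choose k = k.centralBinom * k.choose (l - k) := by
  rw [Nat.choose_mul h, Nat.centralBinom, show 2 * k - k = k by omega]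

lemma sum_antidiagonal_pairBinom_mul (y : ℝ) (l : ℕ) {N : ℕ} (h : l < N) :
    ∑ p ∈ Finset.HasAntidiagonal.antidiagonal l, pairBinom y p.1 * pairBinom y p.2 =
      ∑ k ∈ Finset.range N, ((l.choose k * (2 * k).choose l : ℕ) : ℝ) * pairBinom y k := by
  have e : ∀ p ∈ Finset.HasAntidiagonal.antidiagonal l, pairBinom y p.1 * pairBinom y p.2 =
      ∑ k ∈ Finset.range N, (linCoeff p.1 p.2 k : ℝ) * pairBinom y k := fun p hp =>
    pairBinom_mul y _ _ (by rwa [Finset.HasAntidiagonal.mem_antidiagonal.1 hp])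
  rw [Finset.sum_congr rfl e, Finset.sum_comm]
  refine Finset.sum_congr rfl fun k _ => ?_
  rw [← Finset.sum_mul]
  congr 1
  rw [two_mul, Nat.add_choose_eq, Finset.mul_sum, Nat.cast_sum]
  refine Finset.sum_congr rfl fun p hp => ?_
  rw [linCoeff, Finset.HasAntidiagonal.mem_antidiagonal.1 hp]
  push_cast
  ring

/-- Linearizing in x gives b_l(x) the coefficient ∑ b_p(n) b_q(n) over p + q = l; these products are
then linearized in n. -/
lemma eval_sunS_sq (x : ℝ) {N n : ℕ} (h : n < N) :
    (sunS n).eval x ^ 2 = ∑ k ∈ Finset.range (2 * N),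
      (∑ l ∈ Finset.range (2 * N), ((l.choose k * (2 * k).choose l : ℕ) : ℝ) *
        pairBinom (x * (x + 1)) l) * pairBinom ((n : ℝ) * (n + 1)) k := by
  have e : ∀ i ∈ Finset.range N, ∀ j ∈ Finset.range N,
      ((n.choose i : ℝ) * pairBinom (x * (x + 1)) i) *
        ((n.choose j : ℝ) * pairBinom (x * (x + 1)) j) =
      ∑ l ∈ Finset.range (2 * N), ((n.choose i * n.choose j * linCoeff i j l : ℕ) : ℝ) *
        pairBinom (x * (x + 1)) l := by
    intro i hi j hj
    rw [Finset.mem_range] at hi hj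
    rw [mul_mul_mul_comm, pairBinom_mul _ i j (by omega : i + j < 2 * N), Finset.mul_sum]
    refine Finset.sum_congr rfl fun l _ => ?_
    push_cast
    ring
  rw [eval_sunS x h, sq, Finset.sum_mul_sum,
    Finset.sum_congr rfl fun i hi => Finset.sum_congr rfl (e i hi),
    Finset.sum_congr rfl fun i _ => Finset.sum_comm, Finset.sum_comm]
  simp only [Finset.sum_mul]
  rw [Finset.sum_comm (s := Finset.range (2 * N)) (t := Finset.range (2 * N))]
  refine Finset.sum_congr rfl fun l hl => ?_
  simp only [← Finset.sum_mul, ← Nat.cast_sum]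
  rw [sum_choose_mul_linCoeff n l h]
  push_cast
  simp only [← pairBinom_nat]
  rw [sum_antidiagonal_pairBinom_mul _ l (Finset.mem_range.1 hl), Finset.sum_mul]
  refine Finset.sum_congr rfl fun k _ => ?_
  push_cast
  ring

lemma exists_eval_sunS_sq_nat (x N : ℕ) : ∃ c : ℕ → ℤ, ∀ n < N,
    (sunS n).eval (x : ℝ) ^ 2 = ∑ k ∈ Finset.range (2 * N),
      ((k.centralBinom * c k : ℤ) : ℝ) * pairBinom ((n : ℝ) * (n + 1)) k := by
  -- The coefficients must not depend on n. The `if` removes l < k, where truncated `l - k` would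
  -- give binom(k, 0) = 1 although binom(l, k) = 0.
  refine ⟨fun k => ∑ l ∈ Finset.range (2 * N), if k ≤ l then
    (k.choose (l - k) * (x.choose l * (x + l).choose l) : ℤ) else 0, fun n hn => ?_⟩
  rw [eval_sunS_sq _ hn]
  refine Finset.sum_congr rfl fun k _ => ?_
  congr 1
  push_cast
  rw [Finset.mul_sum]
  refine Finset.sum_congr rfl fun l _ => ?_
  rw [pairBinom_nat]
  split_ifs with hkl
  · have : ((2 * k).choose l * l.choose k : ℝ) = k.centralBinom * k.choose (l - k) := by
      exact_mod_cast choose_mul_choose_eq_centralBinom hkl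
    linear_combination (x.choose l * (x + l).choose l : ℝ) * this
  · simp [Nat.choose_eq_zero_of_lt (by omega : l < k)]

/-! ### Divisibility by n and n^2 -/

/-- The integer linear combinations of the functions `k ↦ binom(k, j) binom(k + j, j)`. -/
noncomputable def pairBinomSpan : Submodule ℤ (ℕ → ℝ) :=
  Submodule.span ℤ (Set.range fun j k : ℕ => pairBinom ((k : ℝ) * (k + 1)) j)

lemma pairBinom_mem_span (j : ℕ) :
    (fun k : ℕ => pairBinom ((k : ℝ) * (k + 1)) j) ∈ pairBinomSpan :=
  Submodule.subset_span ⟨j, rfl⟩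

lemma sum_pairBinom_mem_span (N : ℕ) (a : ℕ → ℤ) :
    (fun k : ℕ => ∑ j ∈ Finset.range N, (a j : ℝ) * pairBinom ((k : ℝ) * (k + 1)) j) ∈
      pairBinomSpan := by
  have h := Submodule.sum_mem pairBinomSpan (t := Finset.range N)
    (f := fun j => a j • fun k : ℕ => pairBinom ((k : ℝ) * (k + 1)) j)
    fun j _ => Submodule.smul_mem _ _ (pairBinom_mem_span j)
  convert h using 1
  ext k
  simp [Finset.sum_apply]

lemma mul_mem_pairBinomSpan {f g : ℕ → ℝ} (hf : f ∈ pairBinomSpan) (hg : g ∈ pairBinomSpan) :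
    f * g ∈ pairBinomSpan := by
  have h : pairBinomSpan * pairBinomSpan ≤ pairBinomSpan := by
    rw [pairBinomSpan, Submodule.span_mul_span, Submodule.span_le]
    rintro _ ⟨_, ⟨i, rfl⟩, _, ⟨j, rfl⟩, rfl⟩
    have hij := sum_pairBinom_mem_span (i + j + 1) fun l => (linCoeff i j l : ℤ)
    simp only [Int.cast_natCast, ← pairBinom_mul _ i j (Nat.lt_succ_self _)] at hij
    exact hij
  exact h (Submodule.mul_mem_mul hf hg)

lemma pow_mem_pairBinomSpan {f : ℕ → ℝ} (hf : f ∈ pairBinomSpan) (m : ℕ) :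
    f ^ m ∈ pairBinomSpan := by
  induction m with
  | zero =>
    convert pairBinom_mem_span 0 using 1
    ext k
    simp
  | succ m ih =>
    rw [pow_succ]
    exact mul_mem_pairBinomSpan ih hf

/-- A weighted sum is divisible by `n` on the whole span as soon as it is on the generators. -/
lemma exists_int_of_mem_pairBinomSpan {w : ℕ → ℝ} {n : ℕ}
    (hw : ∀ j : ℕ, ∃ z : ℤ, 1 / (n : ℝ) *
      ∑ k ∈ Finset.range n, w k * pairBinom ((k : ℝ) * (k + 1)) j = z)
    {f : ℕ → ℝ} (hf : f ∈ pairBinomSpan) :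
    ∃ z : ℤ, 1 / (n : ℝ) * ∑ k ∈ Finset.range n, w k * f k = z := by
  induction hf using Submodule.span_induction with
  | mem f h => obtain ⟨j, rfl⟩ := h; exact hw j
  | zero => exact ⟨0, by simp⟩
  | add f g _ _ hf hg =>
    obtain ⟨a, ha⟩ := hf
    obtain ⟨b, hb⟩ := hg
    exact ⟨a + b, by simp [mul_add, Finset.sum_add_distrib] at *; rw [ha, hb]⟩
  | smul c f _ hf =>
    obtain ⟨a, ha⟩ := hf
    refine ⟨c * a, ?_⟩
    push_cast
    rw [← ha, Finset.mul_sum, Finset.mul_sum, Finset.mul_sum]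
    refine Finset.sum_congr rfl fun k _ => ?_
    simp only [Pi.smul_apply, zsmul_eq_mul]
    ring

lemma sub_mul_pairBinom_nat {n : ℕ} (hn : 0 < n) (j : ℕ) :
    ((n : ℝ) - j) * pairBinom ((n : ℝ) * (n + 1)) j =
      n * ((n - 1).choose j * (n + j).choose j) := by
  obtain ⟨n, rfl⟩ : ∃ m, n = m + 1 := ⟨n - 1, by omega⟩
  have h := cast_succ_choose_mul n j
  rw [pairBinom_nat]
  simp only [Nat.add_sub_cancel]
  push_cast
  linear_combination ((n + 1 + j).choose j : ℝ) * h

lemma inv_mul_sum_odd_mul_pairBinom {n : ℕ} (hn : 0 < n) (j : ℕ) :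
    1 / (n : ℝ) * ∑ k ∈ Finset.range n, (2 * (k : ℝ) + 1) * pairBinom ((k : ℝ) * (k + 1)) j =
      ((n.choose (j + 1) * (n + j).choose j : ℤ) : ℝ) := by
  have hn' : (n : ℝ) ≠ 0 := by positivity
  have hj : (j : ℝ) + 1 ≠ 0 := by positivity
  have h := cast_choose_succ_mul n j
  rw [sum_odd_mul_pairBinom, pairBinom_nat]
  push_cast
  field_simp
  linear_combination -((n + j).choose j : ℝ) * h

lemma inv_mul_sum_alternating_odd_mul_pairBinom {n : ℕ} (hn : 0 < n) (j : ℕ) :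
    1 / (n : ℝ) * ∑ k ∈ Finset.range n,
        (-1) ^ k * (2 * (k : ℝ) + 1) * pairBinom ((k : ℝ) * (k + 1)) j =
      ((-((-1) ^ n * ((n - 1).choose j * (n + j).choose j)) : ℤ) : ℝ) := by
  have hn' : (n : ℝ) ≠ 0 := by positivity
  rw [sum_alternating_odd_mul_pairBinom, sub_mul_pairBinom_nat hn]
  push_cast
  field_simp

/-- Isolates the denominator j + 1 that the coefficients have to absorb. -/
lemma inv_sq_mul_sum_odd_mul_pairBinom {n : ℕ} (hn : 0 < n) (j : ℕ) :
    1 / (n : ℝ) ^ 2 * ∑ k ∈ Finset.range n, (2 * (k : ℝ) + 1) * pairBinom ((k : ℝ) * (k + 1)) j =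
      (((n - 1).choose j * (n + j).choose j : ℤ) : ℝ) / (j + 1) := by
  have hn' : (n : ℝ) ≠ 0 := by positivity
  have hj : (j : ℝ) + 1 ≠ 0 := by positivity
  rw [sum_odd_mul_pairBinom, mul_assoc (n : ℝ), sub_mul_pairBinom_nat hn]
  push_cast
  field_simp

lemma inv_sq_mul_sum_odd_mul_sum {n : ℕ} (hn : 0 < n) (N : ℕ) (a : ℕ → ℤ) {f : ℕ → ℝ}
    (hf : ∀ k < n, f k =
      ∑ j ∈ Finset.range N, (a j : ℝ) * pairBinom ((k : ℝ) * (k + 1)) j) :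
    1 / (n : ℝ) ^ 2 * ∑ k ∈ Finset.range n, (2 * (k : ℝ) + 1) * f k =
      ∑ j ∈ Finset.range N,
        ((a j * ((n - 1).choose j * (n + j).choose j) : ℤ) : ℝ) / (j + 1) := by
  have e : ∀ k ∈ Finset.range n, (2 * (k : ℝ) + 1) * f k = ∑ j ∈ Finset.range N,
      (a j : ℝ) * ((2 * (k : ℝ) + 1) * pairBinom ((k : ℝ) * (k + 1)) j) := fun k hk => by
    rw [hf k (Finset.mem_range.1 hk), Finset.mul_sum]
    exact Finset.sum_congr rfl fun j _ => by ring
  rw [Finset.sum_congr rfl e, Finset.sum_comm, Finset.mul_sum]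
  refine Finset.sum_congr rfl fun j _ => ?_
  rw [← Finset.mul_sum, mul_left_comm, inv_sq_mul_sum_odd_mul_pairBinom hn]
  push_cast
  ring

lemma exists_int_sum {ι : Type*} (s : Finset ι) (f : ι → ℝ) (h : ∀ i ∈ s, ∃ z : ℤ, f i = z) :
    ∃ z : ℤ, ∑ i ∈ s, f i = z := by
  choose! z hz using h
  exact ⟨∑ i ∈ s, z i, by rw [Int.cast_sum]; exact Finset.sum_congr rfl hz⟩

/-- `x (x + 1) binom(x + j, 2 j) / (j + 1)` in terms of binomial coefficients. -/
lemma mul_choose_two_mul (x j : ℕ) :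
    (x : ℝ) * (x + 1) * (x + j).choose (2 * j) =
      (j + 1) * (j * (x + j).choose (2 * j) +
        2 * ((2 * j + 1) * (x + j + 1).choose (2 * j + 2))) := by
  have h1 := cast_choose_succ_mul (x + j) (2 * j)
  have h2 := cast_choose_succ_mul (x + j) (2 * j + 1)
  rw [Nat.choose_succ_succ (x + j) (2 * j + 1)]
  push_cast at *
  rw [Nat.succ_eq_add_one]
  simp only [add_assoc, one_add_one_eq_two] at *
  linear_combination -((x : ℝ) + j + 1) * h1 - (2 * j + 1) * h2

lemma exists_int_even_weight (x j : ℕ) :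
    ∃ z : ℤ, (x : ℝ) * (x + 1) / 2 * (4 ^ j * (x + j).choose (2 * j)) / (j + 1) = z := by
  have hj : (j : ℝ) + 1 ≠ 0 := by positivity
  have h := mul_choose_two_mul x j
  rcases j with _ | j
  -- Here there is no power of 4 to cancel the 1/2, but x (x + 1) / 2 is itself binomial. For
  -- positive index, 4^(j+1) / 2 = 2 * 4^j.
  · refine ⟨(x + 1).choose 2, ?_⟩
    simp at h ⊢
    linarith
  · refine ⟨2 * 4 ^ j * ((j + 1) * (x + (j + 1)).choose (2 * (j + 1)) +
      2 * ((2 * (j + 1) + 1) * (x + (j + 1) + 1).choose (2 * (j + 1) + 2))), ?_⟩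
    rw [div_eq_iff hj, pow_succ]
    push_cast at *
    linear_combination 2 * 4 ^ j * h

/-! ### Reduction to natural x and the six polynomials -/

/-- Integer-valuedness of an expression symmetric under `x ↦ -1 - x` may be tested on `ℕ`. -/
lemma forall_int_of_forall_nat {p : ℝ → Prop} (hp : ∀ x, p (-1 - x) → p x)
    (h : ∀ x : ℕ, p x) (x : ℤ) : p x := by
  rcases le_or_gt 0 x with hx | hx
  · obtain ⟨n, rfl⟩ := Int.eq_ofNat_of_zero_le hx
    exact_mod_cast h n
  · obtain ⟨n, hn⟩ := Int.eq_ofNat_of_zero_le (by omega : 0 ≤ -1 - x)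
    apply hp
    have : (-1 - (x : ℝ)) = (n : ℝ) := by exact_mod_cast hn
    rw [this]
    exact h n

lemma eval_sunD_sq_symm (x : ℝ) (n : ℕ) :
    (sunD n).eval (-1 - x) ^ 2 = (sunD n).eval x ^ 2 := by
  rw [eval_sunD_sq _ (Nat.lt_succ_self n), eval_sunD_sq _ (Nat.lt_succ_self n)]
  congr 1
  ring

lemma eval_sunS_symm (x : ℝ) (n : ℕ) : (sunS n).eval (-1 - x) = (sunS n).eval x := by
  rw [eval_sunS _ (Nat.lt_succ_self n), eval_sunS _ (Nat.lt_succ_self n)]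
  ring_nf

/-- The abstract weight w covers the plain and the alternating sums at once. -/
lemma exists_int_weighted_sunD {w : ℕ → ℝ} {n : ℕ}
    (hw : ∀ j : ℕ, ∃ z : ℤ, 1 / (n : ℝ) *
      ∑ k ∈ Finset.range n, w k * pairBinom ((k : ℝ) * (k + 1)) j = z) (m : ℕ) (x : ℤ) :
    ∃ z : ℤ, 1 / (n : ℝ) *
      ∑ k ∈ Finset.range n, w k * (sunD k).eval (x : ℝ) ^ (2 * m) = z := by
  refine forall_int_of_forall_nat (p := fun x => ∃ z : ℤ, 1 / (n : ℝ) *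
      ∑ k ∈ Finset.range n, w k * (sunD k).eval x ^ (2 * m) = z) (fun x => ?_) (fun x => ?_) x
  · simp only [pow_mul, eval_sunD_sq_symm, imp_self]
  · convert exists_int_of_mem_pairBinomSpan hw (pow_mem_pairBinomSpan (sum_pairBinom_mem_span n
      fun j => (4 ^ j * (x + j).choose (2 * j) : ℤ)) m) using 4
    refine Finset.sum_congr rfl fun k hk => ?_
    rw [pow_mul, eval_sunD_sq_nat x (Finset.mem_range.1 hk), Pi.pow_apply]

lemma exists_int_weighted_sunS {w : ℕ → ℝ} {n : ℕ}
    (hw : ∀ j : ℕ, ∃ z : ℤ, 1 / (n : ℝ) *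
      ∑ k ∈ Finset.range n, w k * pairBinom ((k : ℝ) * (k + 1)) j = z) (m : ℕ) (x : ℤ) :
    ∃ z : ℤ, 1 / (n : ℝ) *
      ∑ k ∈ Finset.range n, w k * (sunS k).eval (x : ℝ) ^ (2 * m) = z := by
  refine forall_int_of_forall_nat (p := fun x => ∃ z : ℤ, 1 / (n : ℝ) *
      ∑ k ∈ Finset.range n, w k * (sunS k).eval x ^ (2 * m) = z) (fun x => ?_) (fun x => ?_) x
  · simp only [eval_sunS_symm, imp_self]
  · obtain ⟨c, hc⟩ := exists_eval_sunS_sq_nat x n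
    convert exists_int_of_mem_pairBinomSpan hw (pow_mem_pairBinomSpan
      (sum_pairBinom_mem_span (2 * n) fun k => (k.centralBinom * c k : ℤ)) m) using 4
    refine Finset.sum_congr rfl fun k hk => ?_
    rw [pow_mul, hc k (Finset.mem_range.1 hk), Pi.pow_apply]

lemma exists_int_sum_sunD_sq {n : ℕ} (hn : 0 < n) (x : ℤ) :
    ∃ z : ℤ, 1 / (2 * (n : ℝ) ^ 2) * ((x : ℝ) * (x + 1)) *
      ∑ k ∈ Finset.range n, (2 * (k : ℝ) + 1) * (sunD k).eval (x : ℝ) ^ 2 = z := by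
  refine forall_int_of_forall_nat (p := fun x => ∃ z : ℤ, 1 / (2 * (n : ℝ) ^ 2) * (x * (x + 1)) *
      ∑ k ∈ Finset.range n, (2 * (k : ℝ) + 1) * (sunD k).eval x ^ 2 = z)
    (fun x => ?_) (fun x => ?_) x
  · simp only [eval_sunD_sq_symm]
    rw [show (-1 - x) * (-1 - x + 1) = x * (x + 1) by ring]
    exact id
  · have e := inv_sq_mul_sum_odd_mul_sum hn n _ fun k hk => eval_sunD_sq_nat x hk
    rw [show ∀ s : ℝ, 1 / (2 * (n : ℝ) ^ 2) * (x * (x + 1)) * s =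
      x * (x + 1) / 2 * (1 / (n : ℝ) ^ 2 * s) by intro s; field_simp, e, Finset.mul_sum]
    refine exists_int_sum _ _ fun j _ => ?_
    obtain ⟨z, hz⟩ := exists_int_even_weight x j
    refine ⟨z * ((n - 1).choose j * (n + j).choose j), ?_⟩
    push_cast
    rw [← hz]
    ring

lemma exists_int_sum_sunS_sq {n : ℕ} (hn : 0 < n) (x : ℤ) :
    ∃ z : ℤ, 1 / (n : ℝ) ^ 2 *
      ∑ k ∈ Finset.range n, (2 * (k : ℝ) + 1) * (sunS k).eval (x : ℝ) ^ 2 = z := by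
  refine forall_int_of_forall_nat (p := fun x => ∃ z : ℤ, 1 / (n : ℝ) ^ 2 *
      ∑ k ∈ Finset.range n, (2 * (k : ℝ) + 1) * (sunS k).eval x ^ 2 = z)
    (fun x => ?_) (fun x => ?_) x
  · simp only [eval_sunS_symm, imp_self]
  · obtain ⟨c, hc⟩ := exists_eval_sunS_sq_nat x n
    rw [inv_sq_mul_sum_odd_mul_sum hn (2 * n) _ hc]
    refine exists_int_sum _ _ fun j _ => ?_
    -- Here d is the j-th Catalan number.
    obtain ⟨d, hd⟩ := Nat.succ_dvd_centralBinom j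
    have hj : (j : ℝ) + 1 ≠ 0 := by positivity
    refine ⟨d * c j * ((n - 1).choose j * (n + j).choose j), ?_⟩
    rw [hd, div_eq_iff hj]
    push_cast
    ring

theorem theorem1p1 (m n : ℕ) (hm : 0 < m) (hn : 0 < n) :
    IsIntegerValued (C (1 / (2 * (n : ℝ) ^ 2)) * (X * (X + 1)) *
        ∑ k ∈ Finset.range n, C (2 * (k : ℝ) + 1) * sunD k ^ 2) ∧
    IsIntegerValued (C (1 / (n : ℝ)) *
        ∑ k ∈ Finset.range n, C (2 * (k : ℝ) + 1) * sunD k ^ (2 * m)) ∧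
    IsIntegerValued (C (1 / (n : ℝ)) *
        ∑ k ∈ Finset.range n, (-1) ^ k * C (2 * (k : ℝ) + 1) * sunD k ^ (2 * m)) ∧
    IsIntegerValued (C (1 / (n : ℝ) ^ 2) *
        ∑ k ∈ Finset.range n, C (2 * (k : ℝ) + 1) * sunS k ^ 2) ∧
    IsIntegerValued (C (1 / (n : ℝ)) *
        ∑ k ∈ Finset.range n, C (2 * (k : ℝ) + 1) * sunS k ^ (2 * m)) ∧
    IsIntegerValued (C (1 / (n : ℝ)) *
        ∑ k ∈ Finset.range n, (-1) ^ k * C (2 * (k : ℝ) + 1) * sunS k ^ (2 * m)) := by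
  have hw : ∀ j : ℕ, ∃ z : ℤ, 1 / (n : ℝ) * ∑ k ∈ Finset.range n,
      (2 * (k : ℝ) + 1) * pairBinom ((k : ℝ) * (k + 1)) j = z :=
    fun j => ⟨_, inv_mul_sum_odd_mul_pairBinom hn j⟩
  have hw' : ∀ j : ℕ, ∃ z : ℤ, 1 / (n : ℝ) * ∑ k ∈ Finset.range n,
      (-1) ^ k * (2 * (k : ℝ) + 1) * pairBinom ((k : ℝ) * (k + 1)) j = z :=
    fun j => ⟨_, inv_mul_sum_alternating_odd_mul_pairBinom hn j⟩
  refine ⟨fun x => ?_, fun x => ?_, fun x => ?_, fun x => ?_, fun x => ?_, fun x => ?_⟩ <;>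
    simp only [eval_mul, eval_C, eval_finsetSum, eval_pow, eval_X, eval_add, eval_one, eval_neg]
  · exact exists_int_sum_sunD_sq hn x
  · exact exists_int_weighted_sunD hw m x
  · exact exists_int_weighted_sunD hw' m x
  · exact exists_int_sum_sunS_sq hn x
  · exact exists_int_weighted_sunS hw m x
  · exact exists_int_weighted_sunS hw' m x
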